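/- For integers $k\ge 0$ and $n\ge 1$ let $\sigma_k(n)=\sum_{d\mid n}d^k$, the sum running over the positive divisors $d$ of $n$, and write $\sigma=\sigma_1$. Then for every integer $n\ge 1$ the following eight identities hold (an empty sum being $0$): (i) $\displaystyle\sum_{m=1}^{n-1}m^3\sigma(m)\sigma(n-m)=\frac1{12}n^3\sigma_3(n)-\frac1{24}n^3(3n-1)\sigma(n)$; (ii) $\displaystyle\sum_{m=1}^{n-1}m^2\sigma(m)\sigma(n-m)=\frac18n^2\sigma_3(n)-\frac1{24}n^2(4n-1)\sigma(n)$; (iii) $\displaystyle\sum_{m=1}^{n-1}m\,\sigma(m)\sigma(n-m)=\frac1{24}n(1-6n)\sigma(n)+\frac5{24}n\sigma_3(n)$; (iv) $\displaystyle\sum_{m=1}^{n-1}m^2\sigma(m)\sigma_3(n-m)=-\frac1{240}n^2\sigma(n)-\frac1{120}n^3\sigma_3(n)+\frac1{80}n^2\sigma_5(n)$; (v) $\displaystyle\sum_{m=1}^{n-1}m\,\sigma(m)\sigma_3(n-m)=-\frac1{240}n\sigma(n)-\frac1{40}n^2\sigma_3(n)+\frac7{240}n\sigma_5(n)$; (vi)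 $\displaystyle\sum_{m=1}^{n-1}m\,\sigma(m)\sigma_5(n-m)=\frac1{504}n\sigma(n)-\frac1{84}n^2\sigma_5(n)+\frac5{504}n\sigma_7(n)$; (vii) $\displaystyle\sum_{m=1}^{n-1}\sigma(m)\sigma_5(n-m)=\frac1{504}\sigma(n)-\frac1{12}n\sigma_5(n)+\frac1{24}\sigma_5(n)+\frac5{126}\sigma_7(n)$; (viii) $\displaystyle\sum_{m=1}^{n-1}\sigma(m)\sigma_7(n-m)=-\frac1{480}\sigma(n)+\frac1{24}\sigma_7(n)+\frac{11}{480}\sigma_9(n)-\frac1{16}n\sigma_7(n)$. -/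

import Mathlib

section

open UpperHalfPlane hiding I
open Complex EisensteinSeries Derivative ModularForm PowerSeries
open scoped Manifold MatrixGroups ArithmeticFunction.sigma

/-! Put S_k = ∑ σ_k(n) qⁿ and θ = q d/dq, which multiplies the n-th coefficient by n. Each sum is a
coefficient of some θ^a S_1 · S_j. Ramanujan's differential equations express θS_1, θS_3, θS_5
through the S_k, and E₄² = E₈, E₄E₆ = E₁₀ express S_7, S_9 through S_3, S_5, so the identities come
down to polynomial algebra in S_1, S_3, S_5. All these relations rest on
`HasQExpansion.eq_zero_of_weight_lt_twelve`, applied to products of Eisenstein series and to their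
Serre derivatives. -/

/-- `f` is the sum of the power series `p` in the parameter `q = exp (2πiτ)`. -/
def HasQExpansion (f : ℍ → ℂ) (p : ℂ⟦X⟧) : Prop :=
  ∀ τ : ℍ, HasSum (fun m ↦ p.coeff m * Function.Periodic.qParam 1 τ ^ m) (f τ)

/-! ### Calculus of q-expansions -/

namespace HasQExpansion

variable {f g : ℍ → ℂ} {p r : ℂ⟦X⟧}

lemma add (hf : HasQExpansion f p) (hg : HasQExpansion g r) : HasQExpansion (f + g) (p + r) :=
  fun τ ↦ by simpa [add_mul] using (hf τ).add (hg τ)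

lemma sub (hf : HasQExpansion f p) (hg : HasQExpansion g r) : HasQExpansion (f - g) (p - r) :=
  fun τ ↦ by simpa [sub_mul] using (hf τ).sub (hg τ)

lemma smul (c : ℂ) (hf : HasQExpansion f p) : HasQExpansion (c • f) (c • p) :=
  fun τ ↦ by simpa [mul_assoc] using (hf τ).mul_left c

lemma mul (hf : HasQExpansion f p) (hg : HasQExpansion g r) : HasQExpansion (f * g) (p * r) := by
  intro τ
  have h := summable_norm_sum_mul_antidiagonal_of_summable_norm (hf τ).summable.norm
    (hg τ).summable.norm
  have h' := tsum_mul_tsum_eq_tsum_sum_antidiagonal_of_summable_norm (hf τ).summable.norm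
    (hg τ).summable.norm
  rw [(hf τ).tsum_eq, (hg τ).tsum_eq] at h'
  rw [Pi.mul_apply, h']
  convert! h.of_norm.hasSum using 2 with n
  rw [coeff_mul, Finset.sum_mul]
  refine Finset.sum_congr rfl fun x hx ↦ ?_
  rw [← Finset.HasAntidiagonal.mem_antidiagonal.mp hx, pow_add]
  ring

lemma isBoundedAtImInfty (hf : HasQExpansion f p) : IsBoundedAtImInfty f :=
  isBoundedAtImInfty_of_hasSum_qExpansion one_pos hf

lemma eq_zero (h : HasQExpansion 0 p) : p = 0 := by
  ext m
  exact (ModularFormClass.qExpansion_coeff_unique (f := (0 : ModularForm 𝒮ℒ 0)) one_pos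
    one_mem_strictPeriods_SL h m).trans (by simp [qExpansion_zero])

/-- The operator `q d/dq` on power series. -/
noncomputable def _root_.PowerSeries.theta : Derivation ℂ ℂ⟦X⟧ ℂ⟦X⟧ := (X : ℂ⟦X⟧) • d⁄dX ℂ

@[simp]
lemma _root_.PowerSeries.coeff_theta (p : ℂ⟦X⟧) (n : ℕ) :
    (theta p).coeff n = n * p.coeff n := by
  cases n with
  | zero => simp [theta]
  | succ n => simp [theta, coeff_succ_X_mul, coeff_derivative, mul_comm]

@[simp]
lemma _root_.PowerSeries.constantCoeff_theta (p : ℂ⟦X⟧) : constantCoeff (theta p) = 0 := by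
  simp [theta]

lemma normalizedDeriv (hf : HasQExpansion f p) : HasQExpansion (D f) (theta p) := by
  intro τ
  let F : ℕ → ℂ → ℂ := fun n w ↦ p.coeff n * Function.Periodic.qParam 1 w ^ n
  have hFd (n : ℕ) (w : ℂ) : HasDerivAt (F n) (2 * Real.pi * I * (n * F n w)) w := by
    have h1 : HasDerivAt (Function.Periodic.qParam 1)
        (Function.Periodic.qParam 1 w * (2 * Real.pi * I)) w := by
      have h : Function.Periodic.qParam 1 = fun w ↦ cexp (2 * Real.pi * I * w) := by
        ext; simp [Function.Periodic.qParam]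
      rw [h]
      simpa using ((hasDerivAt_id w).const_mul (2 * Real.pi * I)).cexp
    convert! (h1.pow n).const_mul (p.coeff n) using 1
    rcases n with - | n
    · simp
    · simp [F, pow_succ]; ring
  -- Since |q| decreases with the height, the terms at half the height of `τ` dominate the series
  -- near `τ`, which justifies termwise differentiation.
  let τ₀ : ℍ := ⟨I * (τ.im / 2 : ℝ), by simpa using τ.im_pos⟩
  let U : Set ℂ := {w | τ.im / 2 < w.im}
  have hU : IsOpen U := isOpen_lt continuous_const continuous_im
  have hle (n : ℕ) (w : ℂ) (hw : w ∈ U) :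
      ‖F n w‖ ≤ ‖p.coeff n * Function.Periodic.qParam 1 τ₀ ^ n‖ := by
    simp only [F, norm_mul, norm_pow]
    gcongr ?_ * ?_ ^ n
    rw [Function.Periodic.norm_qParam, Function.Periodic.norm_qParam]
    have : (τ₀ : ℂ).im ≤ w.im := by simpa [τ₀] using hw.le
    simp only [div_one, Real.exp_le_exp]
    nlinarith [Real.pi_pos]
  have hτ : (τ : ℂ) ∈ U := by simpa [U] using τ.im_pos
  have key := hasSum_deriv_of_summable_norm (hf τ₀).summable.norm
    (fun n w _ ↦ (hFd n w).differentiableAt.differentiableWithinAt) hU hle hτ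
  have hev : f ∘ ofComplex =ᶠ[nhds (τ : ℂ)] fun w ↦ ∑' n, F n w := by
    filter_upwards [isOpen_upperHalfPlaneSet.mem_nhds τ.im_pos] with w hw
    rw [Function.comp_apply, ofComplex_apply_of_im_pos hw]
    exact (hf ⟨w, hw⟩).tsum_eq.symm
  rw [← hev.deriv_eq] at key
  have := key.mul_left (2 * Real.pi * I)⁻¹
  convert! this using 2 with n
  rw [(hFd n τ).deriv, coeff_theta, inv_mul_cancel_left₀ two_pi_I_ne_zero]
  simp [F, mul_assoc]

/-- A holomorphic function on `ℍ`, modular of level one and weight less than `12`, vanishes as soon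
as its constant Fourier coefficient does. -/
lemma eq_zero_of_weight_lt_twelve {k : ℕ} (hk : k < 12) (hf : HasQExpansion f p)
    (hslash : ∀ γ : SL(2, ℤ), f ∣[(k : ℤ)] γ = f) (hhol : MDiff f)
    (h0 : p.coeff 0 = 0) : p = 0 := by
  let F : ModularForm 𝒮ℒ (k : ℤ) :=
    { toFun := f
      slash_action_eq' := fun _ ⟨γ, hγ⟩ ↦ hγ ▸ hslash γ
      holo' := hhol
      bdd_at_cusps' {c} hc := by
        rw [Subgroup.IsArithmetic.isCusp_iff_isCusp_SL2Z] at hc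
        rw [OnePoint.isBoundedAt_iff_forall_SL2Z hc]
        intro γ _
        rw [hslash γ]
        exact hf.isBoundedAtImInfty }
  have hF : F = 0 := by
    -- The Sturm bound `k / 12` is 0, so only the constant coefficient has to be checked.
    apply sturm_bound_levelOne_nat
    rw [Nat.div_eq_of_lt hk]
    refine lt_of_lt_of_le (by norm_num : ((0 : ℕ) : ℕ∞) < (1 : ℕ))
      (PowerSeries.nat_le_order _ _ fun i hi ↦ ?_)
    obtain rfl : i = 0 := by lia
    rw [← h0]
    exact (ModularFormClass.qExpansion_coeff_unique (f := F) one_pos one_mem_strictPeriods_SL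
      hf 0).symm
  have hf0 : f = 0 := congrArg DFunLike.coe hF
  exact eq_zero (hf0 ▸ hf)

end HasQExpansion

/-! ### Eisenstein series and the quasimodularity of E₂ -/

/-- `∑ σ_k(n) qⁿ` as a formal power series. -/
noncomputable def sigmaSeries (k : ℕ) : ℂ⟦X⟧ := .mk fun n ↦ (σ k n : ℂ)

@[simp]
lemma coeff_sigmaSeries (k n : ℕ) : (sigmaSeries k).coeff n = σ k n := by simp [sigmaSeries]

@[simp]
lemma constantCoeff_sigmaSeries (k : ℕ) : constantCoeff (sigmaSeries k) = 0 := by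
  simp [← coeff_zero_eq_constantCoeff_apply]

lemma hasQExpansion_E2 : HasQExpansion E2 (1 + (-24 : ℂ) • sigmaSeries 1) := by
  intro τ
  have h := hasSum_qExpansion_E2 (z := τ)
  convert! h using 2 with n
  rcases eq_or_ne n 0 with rfl | hn
  · simp
  · simp [hn, coeff_one, Function.Periodic.qParam]

lemma hasQExpansion_E {k : ℕ} (hk : 3 ≤ k) (hk2 : Even k) :
    HasQExpansion (E hk) (1 + (-(2 * k / bernoulli k) : ℂ) • sigmaSeries (k - 1)) := by
  intro τ
  have h := ModularForm.hasSum_qExpansion (f := E hk) one_pos one_mem_strictPeriods_SL τ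
  convert! h using 3 with n
  rw [E_qExpansion_coeff hk hk2]
  rcases eq_or_ne n 0 with rfl | hn
  · simp
  · simp [hn, coeff_one]

lemma slash_E {k : ℕ} (hk : 3 ≤ k) (γ : SL(2, ℤ)) : (E hk : ℍ → ℂ) ∣[(k : ℤ)] γ = E hk :=
  SlashInvariantForm.slash_action_eqn (E hk) _ ⟨γ, rfl⟩

lemma D_D2 (γ : SL(2, ℤ)) (z : ℍ) : D (D2 γ) z = - (γ 1 0 / denom γ z : ℂ) ^ 2 := by
  have h := ((hasDerivAt_denom_zpow (γ : GL (Fin 2) ℝ) (-1) z).const_mul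
    (2 * Real.pi * I * γ 1 0))
  have hev : D2 γ ∘ ofComplex =ᶠ[nhds (z : ℂ)]
      fun w ↦ 2 * Real.pi * I * γ 1 0 * denom γ w ^ (-1 : ℤ) := by
    filter_upwards [isOpen_upperHalfPlaneSet.mem_nhds z.im_pos] with w hw
    simp [D2, ofComplex_apply_of_im_pos hw, div_eq_mul_inv]
  rw [normalizedDerivOfComplex, hev.deriv_eq, h.deriv]
  have := denom_ne_zero γ z
  have := two_pi_I_ne_zero
  simp
  field_simp
  simp

/-- The parameter is 1 rather than the weight 2: with D E₂ - E₂²/12 the anomaly of D E₂ cancels that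
of E₂². -/
lemma serreDerivative_E2_slash (γ : SL(2, ℤ)) :
    serreDerivative 1 E2 ∣[(4 : ℤ)] γ = serreDerivative 1 E2 := by
  set c : ℂ := 1 / (2 * riemannZeta 2)
  have hE := E2_slash_action γ
  -- This value, from ζ(2) = π²/6, matches the 1/12 in the Serre derivative.
  have hc : c * (2 * Real.pi * I) ^ 2 = -12 := by
    have := Real.pi_ne_zero
    simp only [c, riemannZeta_two]
    field_simp
    linear_combination 12 * I_sq
  have hc0 : c ≠ 0 := by rintro h; simp [h] at hc
  have hD2 : MDiff (D2 γ) := by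
    have : D2 γ = c⁻¹ • (E2 - E2 ∣[(2 : ℤ)] γ) := by
      rw [hE, sub_sub_cancel, inv_smul_smul₀ hc0]
    rw [this]
    exact (E2_mdifferentiable.sub (E2_mdifferentiable.slash _ _)).const_smul _
  ext z
  set u : ℂ := γ 1 0 / denom γ z
  have hpi := two_pi_I_ne_zero
  have hEz : (E2 ∣[(2 : ℤ)] γ) z = E2 z - c * (2 * Real.pi * I * u) := by
    simp [hE, D2, u, c, mul_div_assoc]
  have h1 := congrFun (normalizedDerivOfComplex_SL_slash (k := 2) E2_mdifferentiable (γ := γ)) z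
  have h2 : D (E2 ∣[(2 : ℤ)] γ) z = D E2 z + c * u ^ 2 := by
    rw [hE, normalizedDerivOfComplex_sub _ _ E2_mdifferentiable (hD2.const_smul c),
      normalizedDerivOfComplex_smul _ _ hD2]
    simp [D_D2, u]
  have h3 : (serreDerivative 1 E2 ∣[(4 : ℤ)] γ) z =
      (D E2 ∣[(4 : ℤ)] γ) z - 12⁻¹ * ((E2 ∣[(2 : ℤ)] γ) z * (E2 ∣[(2 : ℤ)] γ) z) := by
    rw [← Pi.mul_apply, ← mul_slash_SL2]
    simp [SL_slash_apply]
    ring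
  have h4 : D E2 z + c * u ^ 2 = (D E2 ∣[(4 : ℤ)] γ) z -
      2 * (2 * Real.pi * I)⁻¹ * u * (E2 z - c * (2 * Real.pi * I * u)) := by
    rw [← h2, ← hEz, h1]
    simp [u]
  rw [h3, hEz, serreDerivative_apply]
  generalize 2 * Real.pi * I = w at *
  clear_value c u
  field_simp at h4
  refine mul_left_cancel₀ hpi ?_
  linear_combination -h4 + (-c * u ^ 2 * w + 2 * u * E2 z) / 12 * hc

lemma hasQExpansion_E_four :
    HasQExpansion (E (by lia : 3 ≤ 4)) (1 + (240 : ℂ) • sigmaSeries 3) := by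
  convert! hasQExpansion_E (by lia : 3 ≤ 4) ⟨2, rfl⟩ using 3
  norm_num [show bernoulli 4 = -1 / 30 by decide +kernel]

lemma hasQExpansion_E_six :
    HasQExpansion (E (by lia : 3 ≤ 6)) (1 + (-504 : ℂ) • sigmaSeries 5) := by
  convert! hasQExpansion_E (by lia : 3 ≤ 6) ⟨3, rfl⟩ using 3
  norm_num [show bernoulli 6 = 1 / 42 by decide +kernel]

lemma hasQExpansion_E_eight :
    HasQExpansion (E (by lia : 3 ≤ 8)) (1 + (480 : ℂ) • sigmaSeries 7) := by
  convert! hasQExpansion_E (by lia : 3 ≤ 8) ⟨4, rfl⟩ using 3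
  norm_num [show bernoulli 8 = -1 / 30 by decide +kernel]

lemma hasQExpansion_E_ten :
    HasQExpansion (E (by lia : 3 ≤ 10)) (1 + (-264 : ℂ) • sigmaSeries 9) := by
  convert! hasQExpansion_E (by lia : 3 ≤ 10) ⟨5, rfl⟩ using 3
  norm_num [show bernoulli 10 = 5 / 66 by decide +kernel]

lemma HasQExpansion.serreDerivative {f : ℍ → ℂ} {p : ℂ⟦X⟧} (k : ℂ) (hf : HasQExpansion f p) :
    HasQExpansion (serreDerivative k f)
      (theta p - (k * 12⁻¹) • ((1 + (-24 : ℂ) • sigmaSeries 1) * p)) := by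
  convert! hf.normalizedDeriv.sub ((hasQExpansion_E2.mul hf).smul (k * 12⁻¹)) using 1
  ext z
  simp [mul_assoc]

/-- Two level one modular functions of weight less than `12` with the same constant term have the
same Fourier expansion, up to a scalar. -/
lemma HasQExpansion.add_smul_eq_zero {k : ℕ} (hk : k < 12) {f g : ℍ → ℂ} {p r : ℂ⟦X⟧}
    (hf : HasQExpansion f p) (hg : HasQExpansion g r) (hfhol : MDiff f) (hghol : MDiff g)
    (hfs : ∀ γ : SL(2, ℤ), f ∣[(k : ℤ)] γ = f) (hgs : ∀ γ : SL(2, ℤ), g ∣[(k : ℤ)] γ = g)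
    (c : ℂ) (h0 : (p + c • r).coeff 0 = 0) : p + c • r = 0 :=
  (hf.add (hg.smul c)).eq_zero_of_weight_lt_twelve hk
    (fun γ ↦ by rw [SlashAction.add_slash, SL_smul_slash, hfs, hgs])
    (hfhol.add (hghol.const_smul c)) h0

/-! ### Ramanujan's differential equations -/

lemma PowerSeries.theta_ofNat (n : ℕ) [n.AtLeastTwo] : theta (ofNat(n) : ℂ⟦X⟧) = 0 :=
  theta.map_natCast n

/-- Coefficient form of D E₂ = (E₂² - E₄)/12. Here and in the next two lemmas the scalar `12⁻¹`,
`3⁻¹`, `2⁻¹` cancels the constant term -k/12 of the Serre derivative. -/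
lemma theta_sigmaSeries_one :
    theta (sigmaSeries 1) = (1 / 6 : ℂ) •
      (sigmaSeries 1 - 12 * (sigmaSeries 1 * sigmaSeries 1) + 5 * sigmaSeries 3) := by
  have h := HasQExpansion.add_smul_eq_zero (k := 4) (by lia) (hasQExpansion_E2.serreDerivative 1)
    hasQExpansion_E_four (serreDerivative_mdifferentiable 1 E2_mdifferentiable)
    (E (by lia : 3 ≤ 4)).holo' serreDerivative_E2_slash (slash_E _) 12⁻¹ (by simp [theta])
  simp only [map_add, Derivation.map_smul, Derivation.map_one_eq_zero] at h
  linear_combination (norm := algebra) (-1 / 24 : ℂ) • h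

lemma theta_sigmaSeries_three :
    theta (sigmaSeries 3) = (1 / 30 : ℂ) •
      (-sigmaSeries 1 + 10 * sigmaSeries 3 - 240 * (sigmaSeries 1 * sigmaSeries 3) +
        21 * sigmaSeries 5) := by
  have h := HasQExpansion.add_smul_eq_zero (k := 6) (by lia)
    (hasQExpansion_E_four.serreDerivative 4)
    hasQExpansion_E_six (serreDerivative_mdifferentiable 4 (E (by lia : 3 ≤ 4)).holo')
    (E (by lia : 3 ≤ 6)).holo' (fun γ ↦ mod_cast serreDerivative_slash_invariant (k := 4)
      (E (by lia : 3 ≤ 4)).holo' (slash_E _ γ)) (slash_E _) 3⁻¹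
      (by simp [theta]; norm_num)
  simp only [map_add, Derivation.map_smul, Derivation.map_one_eq_zero] at h
  linear_combination (norm := algebra) (1 / 240 : ℂ) • h

lemma theta_sigmaSeries_five :
    theta (sigmaSeries 5) = (1 / 42 : ℂ) •
      (sigmaSeries 1 + 21 * sigmaSeries 5 - 504 * (sigmaSeries 1 * sigmaSeries 5) +
        20 * sigmaSeries 7) := by
  have h := HasQExpansion.add_smul_eq_zero (k := 8) (by lia)
    (hasQExpansion_E_six.serreDerivative 6)
    hasQExpansion_E_eight (serreDerivative_mdifferentiable 6 (E (by lia : 3 ≤ 6)).holo')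
    (E (by lia : 3 ≤ 8)).holo' (fun γ ↦ mod_cast serreDerivative_slash_invariant (k := 6)
      (E (by lia : 3 ≤ 6)).holo' (slash_E _ γ)) (slash_E _) 2⁻¹
      (by simp [theta]; norm_num)
  simp only [map_add, Derivation.map_smul, Derivation.map_one_eq_zero] at h
  linear_combination (norm := algebra) (-1 / 504 : ℂ) • h

/-- This is E₄² = E₈. -/
lemma sigmaSeries_seven :
    sigmaSeries 7 = sigmaSeries 3 + 120 * (sigmaSeries 3 * sigmaSeries 3) := by
  have h := HasQExpansion.add_smul_eq_zero (k := 8) (by lia)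
    (hasQExpansion_E_four.mul hasQExpansion_E_four) hasQExpansion_E_eight
    ((E (by lia : 3 ≤ 4)).holo'.mul (E (by lia : 3 ≤ 4)).holo') (E (by lia : 3 ≤ 8)).holo'
    (fun γ ↦ (mul_slash_SL2 4 4 γ _ _).trans
      (congrArg₂ (· * ·) (slash_E _ γ) (slash_E _ γ))) (slash_E _) (-1) (by simp)
  linear_combination (norm := algebra) (-1 / 480 : ℂ) • h

/-- This is E₄E₆ = E₁₀. -/
lemma sigmaSeries_nine :
    sigmaSeries 9 = (1 / 11 : ℂ) •
      (21 * sigmaSeries 5 - 10 * sigmaSeries 3 + 5040 * (sigmaSeries 3 * sigmaSeries 5)) := by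
  have h := HasQExpansion.add_smul_eq_zero (k := 10) (by lia)
    (hasQExpansion_E_four.mul hasQExpansion_E_six) hasQExpansion_E_ten
    ((E (by lia : 3 ≤ 4)).holo'.mul (E (by lia : 3 ≤ 6)).holo') (E (by lia : 3 ≤ 10)).holo'
    (fun γ ↦ (mul_slash_SL2 4 6 γ _ _).trans
      (congrArg₂ (· * ·) (slash_E _ γ) (slash_E _ γ))) (slash_E _) (-1) (by simp)
  linear_combination (norm := algebra) (1 / 264 : ℂ) • h

/-! ### Convolution identities -/

lemma coeff_mul_sigmaSeries (f : ℂ⟦X⟧) (hf : constantCoeff f = 0) (j n : ℕ) :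
    (f * sigmaSeries j).coeff n =
      ∑ m ∈ Finset.Icc 1 (n - 1), f.coeff m * (σ j (n - m) : ℂ) := by
  rw [coeff_mul, Finset.Nat.sum_antidiagonal_eq_sum_range_succ
    (fun i k ↦ f.coeff i * (sigmaSeries j).coeff k)]
  symm
  simp only [coeff_sigmaSeries]
  refine Finset.sum_subset (fun m hm ↦ by simp at hm ⊢; lia) fun m hm hm' ↦ ?_
  -- The two end terms vanish, by `hf` and by `σ j 0 = 0`.
  obtain rfl | rfl : m = 0 ∨ m = n := by simp at hm hm'; lia
  · simp [hf]
  · simp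

lemma sigmaSeries_theta_two_one_mul_one :
    theta (theta (sigmaSeries 1)) * sigmaSeries 1 =
      (1 / 8 : ℂ) • theta (theta (sigmaSeries 3)) -
        (1 / 6 : ℂ) • theta (theta (theta (sigmaSeries 1))) +
        (1 / 24 : ℂ) • theta (theta (sigmaSeries 1)) := by
  simp only [theta_sigmaSeries_one, theta_sigmaSeries_three, theta_sigmaSeries_five,
    sigmaSeries_seven, map_add, map_sub, map_neg,
    Derivation.map_smul, Derivation.leibniz, smul_eq_mul, map_zero, theta_ofNat]
  algebra

lemma sigmaSeries_theta_three_one_mul_one :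
    theta (theta (theta (sigmaSeries 1))) * sigmaSeries 1 =
      (1 / 12 : ℂ) • theta (theta (theta (sigmaSeries 3))) -
        (1 / 8 : ℂ) • theta (theta (theta (theta (sigmaSeries 1)))) +
        (1 / 24 : ℂ) • theta (theta (theta (sigmaSeries 1))) := by
  have h₁ := congrArg theta sigmaSeries_theta_two_one_mul_one
  have h₂ := congrArg (fun f ↦ theta (theta (theta f))) theta_sigmaSeries_one
  simp only [map_add, map_sub, Derivation.map_smul, Derivation.leibniz, smul_eq_mul, theta_ofNat,
    mul_zero, add_zero] at h₁ h₂
  generalize theta (sigmaSeries 1) = x₁, theta (sigmaSeries 3) = y₁ at *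
  generalize theta x₁ = x₂, theta y₁ = y₂ at *
  generalize theta x₂ = x₃, theta y₂ = y₃ at *
  generalize theta x₃ = x₄ at *
  -- The coefficients are chosen to eliminate the cross term `x₁ * x₂`.
  linear_combination (norm := algebra) (3 / 2 : ℂ) • h₁ - (1 / 8 : ℂ) • h₂

lemma sigmaSeries_theta_one_mul_one :
    theta (sigmaSeries 1) * sigmaSeries 1 =
      (1 / 24 : ℂ) • theta (sigmaSeries 1) - (1 / 4 : ℂ) • theta (theta (sigmaSeries 1)) +
        (5 / 24 : ℂ) • theta (sigmaSeries 3) := by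
  simp only [theta_sigmaSeries_one, theta_sigmaSeries_three,
    map_add, map_sub,
    Derivation.map_smul, Derivation.leibniz, smul_eq_mul, theta_ofNat]
  algebra

lemma sigmaSeries_theta_two_one_mul_three :
    theta (theta (sigmaSeries 1)) * sigmaSeries 3 =
      -(1 / 240 : ℂ) • theta (theta (sigmaSeries 1)) -
        (1 / 120 : ℂ) • theta (theta (theta (sigmaSeries 3))) +
        (1 / 80 : ℂ) • theta (theta (sigmaSeries 5)) := by
  simp only [theta_sigmaSeries_one, theta_sigmaSeries_three, theta_sigmaSeries_five,
    sigmaSeries_seven, map_add, map_sub, map_neg,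
    Derivation.map_smul, Derivation.leibniz, smul_eq_mul, map_zero, theta_ofNat]
  algebra

lemma sigmaSeries_theta_one_mul_three :
    theta (sigmaSeries 1) * sigmaSeries 3 =
      -(1 / 240 : ℂ) • theta (sigmaSeries 1) - (1 / 40 : ℂ) • theta (theta (sigmaSeries 3)) +
        (7 / 240 : ℂ) • theta (sigmaSeries 5) := by
  simp only [theta_sigmaSeries_one, theta_sigmaSeries_three, theta_sigmaSeries_five,
    sigmaSeries_seven, map_add, map_sub, map_neg,
    Derivation.map_smul, Derivation.leibniz, smul_eq_mul, theta_ofNat]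
  algebra

lemma sigmaSeries_theta_one_mul_five :
    theta (sigmaSeries 1) * sigmaSeries 5 =
      (1 / 504 : ℂ) • theta (sigmaSeries 1) - (1 / 84 : ℂ) • theta (theta (sigmaSeries 5)) +
        (5 / 504 : ℂ) • theta (sigmaSeries 7) := by
  simp only [theta_sigmaSeries_one, theta_sigmaSeries_three, theta_sigmaSeries_five,
    sigmaSeries_seven, map_add, map_sub,
    Derivation.map_smul, Derivation.leibniz, smul_eq_mul, theta_ofNat]
  algebra

lemma sigmaSeries_one_mul_five :
    sigmaSeries 1 * sigmaSeries 5 =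
      (1 / 504 : ℂ) • sigmaSeries 1 - (1 / 12 : ℂ) • theta (sigmaSeries 5) +
        (1 / 24 : ℂ) • sigmaSeries 5 + (5 / 126 : ℂ) • sigmaSeries 7 := by
  simp only [theta_sigmaSeries_five, sigmaSeries_seven]
  algebra

lemma sigmaSeries_one_mul_seven :
    sigmaSeries 1 * sigmaSeries 7 =
      -(1 / 480 : ℂ) • sigmaSeries 1 + (1 / 24 : ℂ) • sigmaSeries 7 +
        (11 / 480 : ℂ) • sigmaSeries 9 - (1 / 16 : ℂ) • theta (sigmaSeries 7) := by
  simp only [theta_sigmaSeries_three,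
    sigmaSeries_seven, sigmaSeries_nine, map_add,
    Derivation.leibniz, smul_eq_mul, theta_ofNat]
  algebra

end

open scoped ArithmeticFunction.sigma in
theorem theorem2p9 (n : ℕ) (hn : 1 ≤ n) :
    (∑ m ∈ Finset.Icc 1 (n - 1), (m : ℚ) ^ 3 * (σ 1 m : ℚ) * (σ 1 (n - m) : ℚ)
        = 1 / 12 * (n : ℚ) ^ 3 * (σ 3 n : ℚ)
          - 1 / 24 * (n : ℚ) ^ 3 * (3 * (n : ℚ) - 1) * (σ 1 n : ℚ)) ∧
    (∑ m ∈ Finset.Icc 1 (n - 1), (m : ℚ) ^ 2 * (σ 1 m : ℚ) * (σ 1 (n - m) : ℚ)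
        = 1 / 8 * (n : ℚ) ^ 2 * (σ 3 n : ℚ)
          - 1 / 24 * (n : ℚ) ^ 2 * (4 * (n : ℚ) - 1) * (σ 1 n : ℚ)) ∧
    (∑ m ∈ Finset.Icc 1 (n - 1), (m : ℚ) * (σ 1 m : ℚ) * (σ 1 (n - m) : ℚ)
        = 1 / 24 * (n : ℚ) * (1 - 6 * (n : ℚ)) * (σ 1 n : ℚ)
          + 5 / 24 * (n : ℚ) * (σ 3 n : ℚ)) ∧
    (∑ m ∈ Finset.Icc 1 (n - 1), (m : ℚ) ^ 2 * (σ 1 m : ℚ) * (σ 3 (n - m) : ℚ)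
        = -(1 / 240) * (n : ℚ) ^ 2 * (σ 1 n : ℚ)
          - 1 / 120 * (n : ℚ) ^ 3 * (σ 3 n : ℚ)
          + 1 / 80 * (n : ℚ) ^ 2 * (σ 5 n : ℚ)) ∧
    (∑ m ∈ Finset.Icc 1 (n - 1), (m : ℚ) * (σ 1 m : ℚ) * (σ 3 (n - m) : ℚ)
        = -(1 / 240) * (n : ℚ) * (σ 1 n : ℚ)
          - 1 / 40 * (n : ℚ) ^ 2 * (σ 3 n : ℚ)
          + 7 / 240 * (n : ℚ) * (σ 5 n : ℚ)) ∧
    (∑ m ∈ Finset.Icc 1 (n - 1), (m : ℚ) * (σ 1 m : ℚ) * (σ 5 (n - m) : ℚ)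
        = 1 / 504 * (n : ℚ) * (σ 1 n : ℚ)
          - 1 / 84 * (n : ℚ) ^ 2 * (σ 5 n : ℚ)
          + 5 / 504 * (n : ℚ) * (σ 7 n : ℚ)) ∧
    (∑ m ∈ Finset.Icc 1 (n - 1), (σ 1 m : ℚ) * (σ 5 (n - m) : ℚ)
        = 1 / 504 * (σ 1 n : ℚ)
          - 1 / 12 * (n : ℚ) * (σ 5 n : ℚ)
          + 1 / 24 * (σ 5 n : ℚ)
          + 5 / 126 * (σ 7 n : ℚ)) ∧
    (∑ m ∈ Finset.Icc 1 (n - 1), (σ 1 m : ℚ) * (σ 7 (n - m) : ℚ)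
        = -(1 / 480) * (σ 1 n : ℚ)
          + 1 / 24 * (σ 7 n : ℚ)
          + 11 / 480 * (σ 9 n : ℚ)
          - 1 / 16 * (n : ℚ) * (σ 7 n : ℚ)) := by
  have h₁ := congrArg (PowerSeries.coeff n) sigmaSeries_theta_three_one_mul_one
  have h₂ := congrArg (PowerSeries.coeff n) sigmaSeries_theta_two_one_mul_one
  have h₃ := congrArg (PowerSeries.coeff n) sigmaSeries_theta_one_mul_one
  have h₄ := congrArg (PowerSeries.coeff n) sigmaSeries_theta_two_one_mul_three
  have h₅ := congrArg (PowerSeries.coeff n) sigmaSeries_theta_one_mul_three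
  have h₆ := congrArg (PowerSeries.coeff n) sigmaSeries_theta_one_mul_five
  have h₇ := congrArg (PowerSeries.coeff n) sigmaSeries_one_mul_five
  have h₈ := congrArg (PowerSeries.coeff n) sigmaSeries_one_mul_seven
  rw [coeff_mul_sigmaSeries _ (by simp)] at h₁ h₂ h₃ h₄ h₅ h₆ h₇ h₈
  simp only [map_add, map_sub, PowerSeries.coeff_smul, PowerSeries.coeff_theta, coeff_sigmaSeries, smul_eq_mul,
    ← mul_assoc, ← pow_two, ← pow_succ'] at h₁ h₂ h₃ h₄ h₅ h₆ h₇ h₈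
  -- The coefficient identities live in ℂ and descend to ℚ by injectivity of the cast.
  refine ⟨?_, ?_, ?_, ?_, ?_, ?_, ?_, ?_⟩ <;> apply Rat.cast_injective (α := ℂ) <;> push_cast
  · linear_combination h₁
  · linear_combination h₂
  · linear_combination h₃
  · linear_combination h₄
  · linear_combination h₅
  · linear_combination h₆
  · linear_combination h₇
  · linear_combination h₈
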